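/- Let $\mathcal X,\mathcal Y$ be arbitrary sets, $\ell:\mathcal Y\times\mathcal Y\to[0,1]$ a loss function, $\phi:\mathcal X\to\mathcal Y$ a (deterministic) labelling function, and $\mathcal H$ a set of predictors $h:\mathcal X\to\mathcal Y$; put $\ell_h(x)=\ell(h(x),\phi(x))$. Let $\mathbf X_N\subseteq\mathcal X$ be a set of $N$ points, let $1\le m\le N$, and let $\mathbf X_m\subseteq\mathbf X_N$ be a set of $m$ points sampled uniformly without replacement from $\mathbf X_N$ (i.e. uniformly distributed over the $m$-element subsets of $\mathbf X_N$). For $f:\mathbf X_N\to\mathbb R$ write $$Ef=\frac1N\sum_{x\in\mathbf X_N}f(x),\qquad \hat E_mf=\frac1m\sum_{x\in\mathbf X_m}f(x),$$ and set $L_N(h)=E\ell_h$, $\hat L_m(h)=\hat E_m\ell_h$. Assume that there is $h^*_N\in\mathcal H$ with $L_N(h^*_N)=\inf_{h\in\mathcal H}L_N(h)$, and that, with $\mathcal F^*=\{\ell_h-\ell_{h^*_N}:h\in\mathcal H\}$, there is a constant $B>0$ such that $Ef^2\le B\cdot Ef$ for every $f\in\mathcal F^*$. Let $\psi_m:[0,\infty)\to[0,\infty)$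 be a sub-root function, i.e. $\psi_m$ is nonnegative and nondecreasing and $r\mapsto\psi_m(r)/\sqrt r$ is nonincreasing for $r>0$, such that for all $r\ge0$ $$B\,\mathbb E\Bigl[\sup_{f\in\mathcal F^*:\,Ef^2\le r}\bigl(Ef-\hat E_mf\bigr)\Bigr]\le\psi_m(r),$$ and let $r^*_m>0$ be a positive fixed point of $\psi_m$. For every possible training set $\mathbf X_m$ let $\hat h_m\in\mathcal H$ be an empirical risk minimizer, $\hat L_m(\hat h_m)=\min_{h\in\mathcal H}\hat L_m(h)$. Then for every $t>0$, with probability strictly greater than $1-e^{-t}$ over the draw of $\mathbf X_m$, $$L_N(\hat h_m)-L_N(h^*_N)\le 51\,\frac{r^*_m}{B}+17\,B\,t\,\frac{N}{m^2}.$$ -/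

import Mathlib

namespace Transductive

open scoped BigOperators
open Set

variable {X Y : Type*}

/-- The function `x ↦ ℓ (h x, φ x)`: loss of the predictor `h` at the input `x`, whose label is
`φ x`. -/
def lossOf (ℓ : Y → Y → ℝ) (φ : X → Y) (h : X → Y) : X → ℝ :=
  fun x => ℓ (h x) (φ x)

/-- The average `(1 / #A) ∑_{x ∈ A} f x` over a finite set `A` of inputs. For `A` the full set of
`N` inputs this is `E f`; for `A` a training set of `m` inputs it is the empirical mean of `f`. -/
noncomputable def mean (A : Finset X) (f : X → ℝ) : ℝ :=
  A.expect f

/-- The risk of `h` on the finite set `A` of inputs: the average loss of `h` over `A`. With `A` the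
full set of inputs it is the overall risk `L_N h`; with `A` a training set it is the training
error of `h`. -/
noncomputable def risk (ℓ : Y → Y → ℝ) (φ : X → Y) (A : Finset X) (h : X → Y) : ℝ :=
  mean A (lossOf ℓ φ h)

/-- The excess loss class `{ℓ_h - ℓ_{h₀} : h ∈ H}` relative to the predictor `h₀`. -/
def excessLossClass (ℓ : Y → Y → ℝ) (φ : X → Y) (H : Set (X → Y)) (h₀ : X → Y) :
    Set (X → ℝ) :=
  {f | ∃ h ∈ H, f = lossOf ℓ φ h - lossOf ℓ φ h₀}

/-- Expectation of `g S` when `S` is a set of `m` elements of `XN` drawn uniformly without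
replacement, that is, uniformly among all `m`-element subsets of `XN`. -/
noncomputable def sampleExpectation (XN : Finset X) (m : ℕ) (g : Finset X → ℝ) : ℝ :=
  (XN.powersetCard m).expect g

open Classical in
/-- Probability that `S` satisfies `p` when `S` is a set of `m` elements of `XN` drawn uniformly
without replacement. -/
noncomputable def sampleProb (XN : Finset X) (m : ℕ) (p : Finset X → Prop) : ℝ :=
  (((XN.powersetCard m).filter p).card : ℝ) / ((XN.powersetCard m).card : ℝ)

/-- For a class `F` of functions, a radius `r` and a sample `S`, the supremum of
`E f - (empirical mean of f over S)` over all `f ∈ F` with `E f² ≤ r`. -/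
noncomputable def localizedSup (XN : Finset X) (F : Set (X → ℝ)) (r : ℝ) (S : Finset X) : ℝ :=
  sSup ((fun f : X → ℝ => mean XN f - mean S f) '' {f ∈ F | mean XN (fun x => f x ^ 2) ≤ r})

/-- A sub-root function `ψ : [0, ∞) → [0, ∞)`: nonnegative and nondecreasing, with
`r ↦ ψ r / √r` nonincreasing for `r > 0`. Only the values of `ψ` on `[0, ∞)` matter. -/
structure IsSubRoot (ψ : ℝ → ℝ) : Prop where
  nonneg : ∀ r, 0 ≤ r → 0 ≤ ψ r
  monotoneOn : MonotoneOn ψ (Ici 0)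
  antitoneOn : AntitoneOn (fun r => ψ r / √r) (Ioi 0)

end Transductive

/-! The proof combines concentration for sampling without replacement with localization.
Concentration: the exchange walk on `m`-subsets satisfies the modified logarithmic Sobolev
inequality `card_mul_sliceEntropy_le`, proved by induction on the ground set. Herbst's argument
turns it into the tail `exp (-(u ^ 2 / (8 * v)))` of `card_filter_lt_le`, for a function whose
decrease under each exchange is at most `F y - F x` with `∑ F² ≤ v`. The function `m * sup (E F - Ê
F)` over a family with second moments at most `r` qualifies with `v = N * r`: at each sample take
the maximizing `F`.

Localization: let `f_S` be the excess loss of the minimizer trained on `S`, scaled down by `r / max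
r (E f_S²)` so that its second moment is at most `r`. There are finitely many samples `S`, so the
supremum `Q` runs over a finite family even if `H` is infinite. Peeling and the sub-root property
give `B * E Q ≤ 5 * √(r * rstar)`. With `r = 51 * rstar + 17 * B² * t * N / m²`, the mean plus the
deviation stays below `r / B`. Since `Ê f_S ≤ 0` on the sample `S` itself, the scaled `E f_S` is
below `r / B`; the Bernstein condition then shows that no scaling took place, so `E f_S < r / B`. -/

namespace Transductive

open Finset Real

/-! ### Modified logarithmic Sobolev inequality on the slice. -/

section Slice

variable {α : Type*} [DecidableEq α]

/-- The symmetrized divergence `(a - b) (log a - log b)`. -/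
noncomputable def logDiv (a b : ℝ) : ℝ := (a - b) * (log a - log b)

lemma logDiv_mul {c a b : ℝ} (hc : 0 < c) (ha : 0 < a) (hb : 0 < b) :
    logDiv (c * a) (c * b) = c * logDiv a b := by
  unfold logDiv
  rw [log_mul hc.ne' ha.ne', log_mul hc.ne' hb.ne']
  ring

/-- The log-sum inequality. -/
lemma sum_mul_log_sub_log_le {ι : Type*} (s : Finset ι) (a b : ι → ℝ)
    (ha : ∀ i ∈ s, 0 < a i) (hb : ∀ i ∈ s, 0 < b i) :
    (∑ i ∈ s, a i) * (log (∑ i ∈ s, a i) - log (∑ i ∈ s, b i)) ≤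
      ∑ i ∈ s, a i * (log (a i) - log (b i)) := by
  rcases s.eq_empty_or_nonempty with rfl | hs
  · simp
  have hA : 0 < ∑ i ∈ s, a i := sum_pos ha hs
  have hB : 0 < ∑ i ∈ s, b i := sum_pos hb hs
  set A := ∑ i ∈ s, a i with hAdef
  set C := ∑ i ∈ s, b i with hCdef
  have key : ∀ i ∈ s, a i * (log A - log C) - a i * (log (a i) - log (b i)) ≤
      A / C * b i - a i := by
    intro i hi
    have hai := ha i hi
    have hbi := hb i hi
    -- The bound `log x ≤ x - 1` at this ratio leaves the error `A / C * b i - a i`, which sums to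
    -- zero.
    have h1 : log (A * b i / (C * a i)) ≤ A * b i / (C * a i) - 1 :=
      log_le_sub_one_of_pos (by positivity)
    rw [log_div (by positivity) (by positivity), log_mul hA.ne' hbi.ne',
      log_mul hB.ne' hai.ne'] at h1
    have h2 := mul_le_mul_of_nonneg_left h1 hai.le
    have h3 : a i * (A * b i / (C * a i) - 1) = A / C * b i - a i := by
      field_simp
    rw [h3] at h2
    linarith
  have h := sum_le_sum key
  rw [sum_sub_distrib, sum_sub_distrib, ← sum_mul, ← mul_sum, ← hAdef, ← hCdef,
    div_mul_cancel₀ _ hB.ne'] at h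
  linarith

/-- `logDiv` is the sum of two relative-entropy terms, so the log-sum inequality applies in both
directions. -/
lemma logDiv_sum_le {ι : Type*} (s : Finset ι) (a b : ι → ℝ)
    (ha : ∀ i ∈ s, 0 < a i) (hb : ∀ i ∈ s, 0 < b i) :
    logDiv (∑ i ∈ s, a i) (∑ i ∈ s, b i) ≤ ∑ i ∈ s, logDiv (a i) (b i) := by
  have h1 := sum_mul_log_sub_log_le s a b ha hb
  have h2 := sum_mul_log_sub_log_le s b a hb ha
  have h3 : ∑ i ∈ s, logDiv (a i) (b i) =
      ∑ i ∈ s, a i * (log (a i) - log (b i)) + ∑ i ∈ s, b i * (log (b i) - log (a i)) := by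
    rw [← sum_add_distrib]
    exact sum_congr rfl fun i _ => by unfold logDiv; ring
  rw [h3]
  unfold logDiv
  linarith

/-- Modified logarithmic Sobolev inequality on the two-point space. -/
lemma two_point_entropy_le {z₀ z₁ a b : ℝ} (h₀ : 0 < z₀) (h₁ : 0 < z₁) (ha : 0 < a) (hb : 0 < b) :
    z₀ * a * log a + z₁ * b * log b -
        (z₀ * a + z₁ * b) * log ((z₀ * a + z₁ * b) / (z₀ + z₁)) ≤
      z₀ * z₁ / (z₀ + z₁) * logDiv a b := by
  have hz : 0 < z₀ + z₁ := by positivity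
  -- Bounding the logarithm of the mean from below by concavity makes the left side collapse exactly
  -- to the `logDiv` term.
  have hc := strictConcaveOn_log_Ioi.concaveOn.2 (Set.mem_Ioi.2 ha) (Set.mem_Ioi.2 hb)
    (div_pos h₀ hz).le (div_pos h₁ hz).le (by field_simp)
  simp only [smul_eq_mul] at hc
  have e : z₀ / (z₀ + z₁) * a + z₁ / (z₀ + z₁) * b = (z₀ * a + z₁ * b) / (z₀ + z₁) := by ring
  rw [e] at hc
  have h := mul_le_mul_of_nonneg_left hc (by positivity : 0 ≤ z₀ * a + z₁ * b)
  have e2 : (z₀ * a + z₁ * b) * (z₀ / (z₀ + z₁) * log a + z₁ / (z₀ + z₁) * log b) =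
      z₀ * a * log a + z₁ * b * log b - z₀ * z₁ / (z₀ + z₁) * logDiv a b := by
    unfold logDiv
    field_simp
    ring
  linarith

/-- The set obtained from `S` by exchanging `x` for `y`. -/
def exchange (S : Finset α) (x y : α) : Finset α := insert y (S.erase x)

/-- The unnormalized entropy of `f` under the uniform distribution on `m`-subsets of `U`. -/
noncomputable def sliceEntropy (U : Finset α) (m : ℕ) (f : Finset α → ℝ) : ℝ :=
  ∑ S ∈ U.powersetCard m, f S * log (f S) -
    (∑ S ∈ U.powersetCard m, f S) *
      log ((∑ S ∈ U.powersetCard m, f S) / ((U.powersetCard m).card : ℝ))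

/-- The unnormalized Dirichlet form of the exchange dynamics on `m`-subsets of `U`, evaluated at
`f` and `log f`. -/
noncomputable def sliceDirichlet (U : Finset α) (m : ℕ) (f : Finset α → ℝ) : ℝ :=
  ∑ S ∈ U.powersetCard m, ∑ x ∈ S, ∑ y ∈ U \ S, logDiv (f S) (f (exchange S x y))

lemma sum_powersetCard_succ_erase {U : Finset α} {i : α} (hi : i ∈ U) (k : ℕ)
    (G : Finset α → ℝ) :
    ∑ S ∈ U.powersetCard (k + 1), G S =
      ∑ S ∈ (U.erase i).powersetCard (k + 1), G S +
        ∑ S ∈ (U.erase i).powersetCard k, G (insert i S) := by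
  conv_lhs => rw [← insert_erase hi]
  rw [powersetCard_succ_insert (notMem_erase i U), sum_union, sum_image]
  · intro S hS T hT h
    have hS' : i ∉ S := fun h' => notMem_erase i U ((mem_powersetCard.1 hS).1 h')
    have hT' : i ∉ T := fun h' => notMem_erase i U ((mem_powersetCard.1 hT).1 h')
    rw [← erase_insert hS', ← erase_insert hT', h]
  · rw [disjoint_left]
    intro S hS hS'
    obtain ⟨T, -, rfl⟩ := mem_image.1 hS'
    exact notMem_erase i U ((mem_powersetCard.1 hS).1 (mem_insert_self i T))

/-- Double counting of pairs `T ⊂ S` differing by one point; it serves both for reversibility and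
for counting exchanges. -/
lemma sum_powersetCard_succ_sum_erase (U : Finset α) (k : ℕ) (G : Finset α → α → ℝ) :
    ∑ S ∈ U.powersetCard (k + 1), ∑ x ∈ S, G (S.erase x) x =
      ∑ T ∈ U.powersetCard k, ∑ x ∈ U \ T, G T x := by
  rw [sum_sigma', sum_sigma']
  refine sum_bij' (fun p _ => ⟨p.1.erase p.2, p.2⟩) (fun p _ => ⟨insert p.2 p.1, p.2⟩)
    ?_ ?_ ?_ ?_ ?_
  · rintro ⟨S, x⟩ h
    simp only [mem_sigma, mem_powersetCard, mem_sdiff] at h ⊢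
    refine ⟨⟨(erase_subset _ _).trans h.1.1, ?_⟩, h.1.1 h.2, notMem_erase x S⟩
    rw [card_erase_of_mem h.2, h.1.2]; rfl
  · rintro ⟨S, x⟩ h
    simp only [mem_sigma, mem_powersetCard, mem_sdiff] at h ⊢
    refine ⟨⟨insert_subset h.2.1 h.1.1, ?_⟩, mem_insert_self x S⟩
    rw [card_insert_of_notMem h.2.2, h.1.2]
  · rintro ⟨S, x⟩ h
    simp only [mem_sigma] at h
    simp [insert_erase h.2]
  · rintro ⟨S, x⟩ h
    simp only [mem_sigma, mem_sdiff] at h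
    simp [erase_insert h.2.2]
  · rintro ⟨S, x⟩ h
    rfl

/-- The exchange dynamics on the slice is reversible. -/
lemma sum_exchange_symm (U : Finset α) (m : ℕ) (G : Finset α → Finset α → ℝ) :
    ∑ S ∈ U.powersetCard m, ∑ x ∈ S, ∑ y ∈ U \ S, G (exchange S x y) S =
      ∑ S ∈ U.powersetCard m, ∑ x ∈ S, ∑ y ∈ U \ S, G S (exchange S x y) := by
  cases m with
  | zero => simp
  | succ k =>
    -- Deleting `x` leaves a common `k`-set `T`, and an exchange becomes an ordered pair of distinct
    -- points outside `T`. Reversal just swaps the pair; the diagonal is padded with `0`.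
    have key : ∀ G : Finset α → Finset α → ℝ,
        ∑ S ∈ U.powersetCard (k + 1), ∑ x ∈ S, ∑ y ∈ U \ S, G S (exchange S x y) =
        ∑ T ∈ U.powersetCard k, ∑ x ∈ U \ T, ∑ y ∈ (U \ T),
          if x = y then 0 else G (insert x T) (insert y T) := by
      intro G
      rw [← sum_powersetCard_succ_sum_erase U k
        (fun T x => ∑ y ∈ (U \ T), if x = y then 0 else G (insert x T) (insert y T))]
      refine sum_congr rfl fun S hS => sum_congr rfl fun x hx => ?_
      have hSU := (mem_powersetCard.1 hS).1
      have : U \ S.erase x = insert x (U \ S) := by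
        ext z
        simp only [mem_sdiff, mem_erase, mem_insert]
        by_cases hz : z = x
        · subst hz; simp [hSU hx]
        · simp [hz]
      rw [this, sum_insert (by simp [hx]), insert_erase hx]
      simp only [if_true, zero_add]
      refine sum_congr rfl fun y hy => ?_
      rw [if_neg]
      · rfl
      · rintro rfl; exact (mem_sdiff.1 hy).2 hx
    rw [key G, key (fun A C => G C A)]
    refine sum_congr rfl fun T _ => ?_
    rw [sum_comm]
    exact sum_congr rfl fun x _ => sum_congr rfl fun y _ => by simp only [eq_comm]

lemma sliceDirichlet_erase_add {U : Finset α} {i : α} (hi : i ∈ U) (k : ℕ) (f : Finset α → ℝ) :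
    sliceDirichlet (U.erase i) (k + 1) f +
        sliceDirichlet (U.erase i) k (fun S => f (insert i S)) =
      ∑ S ∈ U.powersetCard (k + 1), ∑ x ∈ S, ∑ y ∈ U \ S,
        if i = x ∨ i = y then 0 else logDiv (f S) (f (exchange S x y)) := by
  rw [sum_powersetCard_succ_erase hi]
  unfold sliceDirichlet
  congr 1
  · refine sum_congr rfl fun S hS => sum_congr rfl fun x hx => ?_
    have hiS : i ∉ S := fun h' => notMem_erase i U ((mem_powersetCard.1 hS).1 h')
    have : U \ S = insert i (U.erase i \ S) := by
      ext z
      by_cases hz : z = i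
      · subst hz; simp [hi, hiS]
      · simp [hz]
    rw [this, sum_insert (by simp)]
    simp only [or_true, if_true, zero_add]
    refine sum_congr rfl fun y hy => ?_
    rw [if_neg]
    rintro (rfl | rfl)
    · exact hiS hx
    · simp at hy
  · refine sum_congr rfl fun S hS => ?_
    have hiS : i ∉ S := fun h' => notMem_erase i U ((mem_powersetCard.1 hS).1 h')
    rw [sum_insert hiS]
    simp only [true_or, if_true, sum_const_zero, zero_add]
    refine sum_congr rfl fun x hx => ?_
    have hxi : i ≠ x := by rintro rfl; exact hiS hx
    have : U \ insert i S = U.erase i \ S := by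
      ext z
      simp only [mem_sdiff, mem_insert, mem_erase]
      tauto
    rw [this]
    refine sum_congr rfl fun y hy => ?_
    have hyi : i ≠ y := by rintro rfl; simp at hy
    rw [if_neg (by simp [hxi, hyi])]
    unfold exchange
    rw [erase_insert_of_ne hxi, insert_comm]

/-- Fixing the status of `i` keeps exactly the exchanges that do not move `i`, so each one survives
for all but two choices of `i`. -/
lemma sum_sliceDirichlet_erase (U : Finset α) (k : ℕ) (f : Finset α → ℝ) :
    ∑ i ∈ U, (sliceDirichlet (U.erase i) (k + 1) f +
        sliceDirichlet (U.erase i) k (fun S => f (insert i S))) =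
      ((U.card : ℝ) - 2) * sliceDirichlet U (k + 1) f := by
  rw [sum_congr rfl fun i hi => sliceDirichlet_erase_add hi k f, sum_comm]
  unfold sliceDirichlet
  rw [mul_sum]
  refine sum_congr rfl fun S hS => ?_
  rw [sum_comm, mul_sum]
  refine sum_congr rfl fun x hx => ?_
  rw [sum_comm, mul_sum]
  refine sum_congr rfl fun y hy => ?_
  have hxU : x ∈ U := (mem_powersetCard.1 hS).1 hx
  have hyU : y ∈ U := (mem_sdiff.1 hy).1
  have hxy : x ≠ y := by rintro rfl; exact (mem_sdiff.1 hy).2 hx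
  rw [← add_sum_erase U _ hxU, ← add_sum_erase (U.erase x) _ (mem_erase.2 ⟨hxy.symm, hyU⟩)]
  simp only [true_or, or_true, if_true, zero_add]
  rw [sum_congr rfl (g := fun _ => logDiv (f S) (f (exchange S x y)))]
  · rw [sum_const, nsmul_eq_mul]
    congr 1
    have h1 := card_erase_add_one hxU
    have h2 := card_erase_add_one (mem_erase.2 ⟨hxy.symm, hyU⟩)
    rw [← h1, ← h2]
    push_cast
    ring
  · intro i hi
    simp only [mem_erase] at hi
    rw [if_neg (by tauto)]

/-- Chain rule for entropy, conditioning on whether `i ∈ S`. What remains is the entropy of the two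
block averages, bounded by the two-point inequality and then spread over the exchanges that bring in
`i`. -/
lemma sliceEntropy_le_erase {U : Finset α} {i : α} (hi : i ∈ U) {k : ℕ} (hk : k + 1 < U.card)
    {f : Finset α → ℝ} (hf : ∀ S, 0 < f S) :
    sliceEntropy U (k + 1) f ≤
      (sliceEntropy (U.erase i) (k + 1) f +
        sliceEntropy (U.erase i) k (fun S => f (insert i S))) +
      (U.card : ℝ)⁻¹ * ∑ S ∈ (U.erase i).powersetCard (k + 1), ∑ x ∈ S,
        logDiv (f S) (f (exchange S x i)) := by
  set V := U.erase i with hV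
  have hVc : V.card + 1 = U.card := card_erase_add_one hi
  set n := V.card - k with hn
  have hnk : (n : ℝ) + (k + 1) = U.card := by
    have : n + (k + 1) = U.card := by omega
    exact_mod_cast this
  have hn0 : (0 : ℝ) < n := by
    have : 0 < n := by omega
    exact_mod_cast this
  set z₀ : ℝ := ((V.powersetCard (k + 1)).card : ℝ) with hz₀
  set z₁ : ℝ := ((V.powersetCard k).card : ℝ) with hz₁
  have hz : ((U.powersetCard (k + 1)).card : ℝ) = z₀ + z₁ := by
    have := sum_powersetCard_succ_erase hi k (fun _ => (1 : ℝ))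
    simpa [hz₀, hz₁] using this
  have hne₀ : (V.powersetCard (k + 1)).Nonempty := powersetCard_nonempty.2 (by omega)
  have hne₁ : (V.powersetCard k).Nonempty := powersetCard_nonempty.2 (by omega)
  have hz₀p : 0 < z₀ := by rw [hz₀]; exact_mod_cast hne₀.card_pos
  have hz₁p : 0 < z₁ := by rw [hz₁]; exact_mod_cast hne₁.card_pos
  set F₀ := ∑ S ∈ V.powersetCard (k + 1), f S with hF₀
  set F₁ := ∑ S ∈ V.powersetCard k, f (insert i S) with hF₁
  have hF₀p : 0 < F₀ := sum_pos (fun S _ => hf S) hne₀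
  have hF₁p : 0 < F₁ := sum_pos (fun S _ => hf _) hne₁
  have hcard : ∀ T ∈ V.powersetCard k, ((V \ T).card : ℝ) = n := by
    intro T hT
    rw [mem_powersetCard] at hT
    rw [card_sdiff_of_subset hT.1, hT.2]
  have hzz : z₀ * (k + 1) = z₁ * n := by
    have h := sum_powersetCard_succ_sum_erase V k (fun _ _ => (1 : ℝ))
    simp only [sum_const, nsmul_eq_mul, mul_one] at h
    rw [sum_congr rfl hcard, sum_congr rfl (g := fun _ => ((k : ℝ) + 1))] at h
    · simpa only [sum_const, nsmul_eq_mul] using h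
    · intro S hS
      rw [(mem_powersetCard.1 hS).2]; push_cast; ring
  have hpair₀ : ∑ S ∈ V.powersetCard (k + 1), ∑ _x ∈ S, f S = (k + 1) * F₀ := by
    rw [hF₀, mul_sum]
    refine sum_congr rfl fun S hS => ?_
    rw [sum_const, (mem_powersetCard.1 hS).2, nsmul_eq_mul]; push_cast; ring
  -- The exchange forgets `x`, so each `insert i T` is reached once for every point of `V \ T`, that
  -- is `n` times.
  have hpair₁ : ∑ S ∈ V.powersetCard (k + 1), ∑ x ∈ S, f (exchange S x i) = n * F₁ := by
    have h := sum_powersetCard_succ_sum_erase V k (fun T _ => f (insert i T))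
    unfold exchange
    rw [h, hF₁, mul_sum]
    refine sum_congr rfl fun T hT => ?_
    rw [sum_const, nsmul_eq_mul, hcard T hT]
  have hlog : logDiv ((k + 1) * F₀) (n * F₁) ≤
      ∑ S ∈ V.powersetCard (k + 1), ∑ x ∈ S, logDiv (f S) (f (exchange S x i)) := by
    rw [← hpair₀, ← hpair₁, sum_sigma', sum_sigma', sum_sigma']
    exact logDiv_sum_le _ (fun p : (_ : Finset α) × α => f p.1)
      (fun p => f (exchange p.1 p.2 i)) (fun _ _ => hf _) (fun _ _ => hf _)
  have hscale : logDiv ((k + 1) * F₀) (n * F₁) = z₁ * n * logDiv (F₀ / z₀) (F₁ / z₁) := by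
    rw [← logDiv_mul (by positivity) (by positivity) (by positivity)]
    congr 1
    · rw [← hzz]; field_simp
    · field_simp
  have htwo := two_point_entropy_le hz₀p hz₁p (div_pos hF₀p hz₀p) (div_pos hF₁p hz₁p)
  have hcoef : z₀ * z₁ / (z₀ + z₁) = (U.card : ℝ)⁻¹ * (z₁ * n) := by
    have hU : (0 : ℝ) < U.card := by rw [← hnk]; positivity
    field_simp
    rw [← hnk]
    linear_combination hzz
  rw [hcoef, mul_assoc (U.card : ℝ)⁻¹, ← hscale] at htwo
  have htwo' := htwo.trans (mul_le_mul_of_nonneg_left hlog (by positivity))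
  rw [mul_div_cancel₀ _ hz₀p.ne', mul_div_cancel₀ _ hz₁p.ne'] at htwo'
  unfold sliceEntropy
  rw [sum_powersetCard_succ_erase hi k (fun S => f S * log (f S)),
    sum_powersetCard_succ_erase hi k f, hz]
  linarith

/-- Modified logarithmic Sobolev inequality for the exchange dynamics on the slice. -/
theorem card_mul_sliceEntropy_le (U : Finset α) (m : ℕ) (f : Finset α → ℝ) (hf : ∀ S, 0 < f S) :
    (U.card : ℝ) * sliceEntropy U m f ≤ sliceDirichlet U m f := by
  induction hN : U.card generalizing U m f with
  | zero =>
    have : U = ∅ := card_eq_zero.1 hN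
    subst this
    cases m <;> simp [sliceDirichlet]
  | succ n ih =>
    rcases m with _ | k
    · simp [sliceEntropy, sliceDirichlet]
    rcases lt_trichotomy (k + 1) (n + 1) with hlt | heq | hgt
    · have hcU : k + 1 < U.card := by omega
      have hn : (0 : ℝ) < n := by
        have : 0 < n := by omega
        exact_mod_cast this
      have hstep : ∀ i ∈ U, (n : ℝ) * sliceEntropy U (k + 1) f ≤
          (sliceDirichlet (U.erase i) (k + 1) f +
            sliceDirichlet (U.erase i) k (fun S => f (insert i S))) +
          n * (U.card : ℝ)⁻¹ * ∑ S ∈ U.powersetCard (k + 1), ∑ x ∈ S,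
            ∑ y ∈ U \ S, if y = i then logDiv (f S) (f (exchange S x y)) else 0 := by
        intro i hi
        have hc : (U.erase i).card = n := by rw [card_erase_of_mem hi, hN]; rfl
        have h1 := ih (U.erase i) (k + 1) f hf hc
        have h2 := ih (U.erase i) k (fun S => f (insert i S)) (fun S => hf _) hc
        have h3 := mul_le_mul_of_nonneg_left (sliceEntropy_le_erase hi hcU hf) hn.le
        have h4 : ∑ S ∈ U.powersetCard (k + 1), ∑ x ∈ S,
            ∑ y ∈ U \ S, (if y = i then logDiv (f S) (f (exchange S x y)) else 0) =
            ∑ S ∈ (U.erase i).powersetCard (k + 1), ∑ x ∈ S,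
              logDiv (f S) (f (exchange S x i)) := by
          rw [sum_powersetCard_succ_erase hi, add_eq_left.2]
          · refine sum_congr rfl fun S hS => sum_congr rfl fun x hx => ?_
            have hiS : i ∉ S := fun h' => notMem_erase i U ((mem_powersetCard.1 hS).1 h')
            rw [sum_ite_eq' , if_pos (mem_sdiff.2 ⟨hi, hiS⟩)]
          · refine sum_eq_zero fun S hS => sum_eq_zero fun x hx => ?_
            rw [sum_ite_eq', if_neg (by simp)]
        rw [h4]
        linarith
      -- With `N = n + 1`, entropy `Ent` and Dirichlet form `D`, summing over `i` gives `n * N * Ent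
      -- ≤ (N - 2) * D + (n / N) * D ≤ n * D`: each exchange brings in exactly one `i`.
      have hsum := sum_le_sum hstep
      rw [sum_add_distrib, sum_sliceDirichlet_erase, sum_const, nsmul_eq_mul, ← mul_sum,
        sum_comm] at hsum
      have hD : ∑ S ∈ U.powersetCard (k + 1), ∑ i ∈ U, ∑ x ∈ S, ∑ y ∈ U \ S,
          (if y = i then logDiv (f S) (f (exchange S x y)) else 0) =
          sliceDirichlet U (k + 1) f := by
        refine sum_congr rfl fun S hS => ?_
        rw [sum_comm]
        refine sum_congr rfl fun x hx => ?_
        rw [sum_comm]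
        refine sum_congr rfl fun y hy => ?_
        rw [sum_ite_eq, if_pos (mem_sdiff.1 hy).1]
      have hDn : 0 ≤ sliceDirichlet U (k + 1) f := by
        refine sum_nonneg fun S _ => sum_nonneg fun x _ => sum_nonneg fun y _ => ?_
        unfold logDiv
        rcases le_total (f S) (f (exchange S x y)) with h | h
        · exact mul_nonneg_of_nonpos_of_nonpos (sub_nonpos.2 h)
            (sub_nonpos.2 (log_le_log (hf _) h))
        · exact mul_nonneg (sub_nonneg.2 h) (sub_nonneg.2 (log_le_log (hf _) h))
      rw [hD, hN] at hsum
      push_cast at hsum ⊢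
      have hfac : (n : ℝ) * ((n : ℝ) + 1)⁻¹ ≤ 1 := by
        rw [← div_eq_mul_inv, div_le_one (by positivity)]; linarith
      have := mul_le_mul_of_nonneg_right hfac hDn
      have h5 : (n : ℝ) * ((n + 1) * sliceEntropy U (k + 1) f) ≤
          n * sliceDirichlet U (k + 1) f := by linarith
      exact le_of_mul_le_mul_left h5 hn
    · have : U.powersetCard (k + 1) = {U} := by rw [heq, ← hN, powersetCard_self]
      simp [sliceEntropy, sliceDirichlet, this]
    · have : U.powersetCard (k + 1) = ∅ := powersetCard_eq_empty.2 (by omega)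
      simp [sliceEntropy, sliceDirichlet, this]

end Slice

/-! ### From entropy to concentration. -/

/-- Herbst's argument: an entropy bound for exponentials implies a sub-Gaussian bound on the
moment generating function. -/
lemma sum_exp_le_of_entropy_le {β : Type*} {s : Finset β} (hs : s.Nonempty) (g : β → ℝ) (c : ℝ)
    (h : ∀ r : ℝ, 0 < r → ∑ b ∈ s, exp (r * g b) * (r * g b) -
      (∑ b ∈ s, exp (r * g b)) * log ((∑ b ∈ s, exp (r * g b)) / (s.card : ℝ)) ≤
        c * r ^ 2 * ∑ b ∈ s, exp (r * g b)) {r : ℝ} (hr : 0 < r) :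
    (∑ b ∈ s, exp (r * g b)) / (s.card : ℝ) ≤
      exp (r * ((∑ b ∈ s, g b) / (s.card : ℝ)) + c * r ^ 2) := by
  have hZ : (0 : ℝ) < s.card := by exact_mod_cast hs.card_pos
  set M : ℝ → ℝ := fun r => (∑ b ∈ s, exp (r * g b)) / (s.card : ℝ) with hM
  set M' : ℝ → ℝ := fun r => (∑ b ∈ s, exp (r * g b) * g b) / (s.card : ℝ) with hM'
  have hMpos : ∀ r, 0 < M r := fun r => div_pos (sum_pos (fun b _ => exp_pos _) hs) hZ
  have hMd : ∀ r, HasDerivAt M (M' r) r := by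
    intro r
    refine HasDerivAt.div_const (HasDerivAt.fun_sum fun b _ => ?_) _
    simpa using ((hasDerivAt_id r).mul_const (g b)).exp
  set K : ℝ → ℝ := fun r => log (M r) with hK
  have hKd : ∀ r, HasDerivAt K (M' r / M r) r := fun r => (hMd r).log (hMpos r).ne'
  have hM0 : M 0 = 1 := by simp [hM, hZ.ne']
  have hK0 : K 0 = 0 := by simp [hK, hM0]
  have hineq : ∀ r, 0 < r → r * (M' r / M r) - K r ≤ c * r ^ 2 := by
    intro r hr
    have h1 := h r hr
    have e1 : ∑ b ∈ s, exp (r * g b) * (r * g b) = r * (M' r * s.card) := by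
      rw [hM']
      simp only
      rw [div_mul_cancel₀ _ hZ.ne', mul_sum]
      exact sum_congr rfl fun b _ => by ring
    have e2 : ∑ b ∈ s, exp (r * g b) = M r * s.card := by
      rw [hM]; simp only; rw [div_mul_cancel₀ _ hZ.ne']
    rw [e1, e2, mul_div_assoc, div_self hZ.ne', mul_one] at h1
    have hp : 0 < M r * s.card := mul_pos (hMpos r) hZ
    refine le_of_mul_le_mul_right ?_ hp
    have e3 : (r * (M' r / M r) - K r) * (M r * s.card) =
        r * (M' r * s.card) - M r * s.card * log (M r) := by
      have e4 : M' r / M r * M r = M' r := div_mul_cancel₀ _ (hMpos r).ne'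
      simp only [hK]
      linear_combination r * s.card * e4
    rw [e3]
    exact h1
  set u : ℝ → ℝ := fun r => K r / r - c * r with hu
  have hud : ∀ r, 0 < r → HasDerivAt u ((M' r / M r * r - K r * 1) / r ^ 2 - c * 1) r :=
    fun r hr => ((hKd r).div (hasDerivAt_id r) hr.ne').sub ((hasDerivAt_id r).const_mul c)
  -- The entropy bound says exactly that `K r / r - c * r` has nonpositive derivative; its limit at
  -- `0` is `K' 0`, the mean of `g`.
  have hanti : AntitoneOn u (Set.Ioi 0) := by
    refine antitoneOn_of_deriv_nonpos (convex_Ioi 0)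
      (fun r hr => (hud r hr).continuousAt.continuousWithinAt)
      (fun r hr => ?_) (fun r hr => ?_)
    · rw [interior_Ioi] at hr
      exact (hud r hr).differentiableAt.differentiableWithinAt
    · rw [interior_Ioi] at hr
      have hr' : 0 < r := hr
      rw [(hud r hr).deriv, mul_one, mul_one, sub_nonpos, div_le_iff₀ (by positivity)]
      linarith [hineq r hr]
  have hlim : Filter.Tendsto u (nhdsWithin 0 (Set.Ioi 0))
      (nhds ((∑ b ∈ s, g b) / (s.card : ℝ))) := by
    have h1 : Filter.Tendsto (slope K 0) (nhdsWithin 0 (Set.Ioi 0)) (nhds (M' 0 / M 0)) :=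
      (hasDerivAt_iff_tendsto_slope.1 (hKd 0)).mono_left
        (nhdsWithin_mono _ fun x hx => (ne_of_gt hx : x ≠ 0))
    have h2 : Filter.Tendsto (fun r : ℝ => c * r) (nhdsWithin 0 (Set.Ioi 0)) (nhds (c * 0)) :=
      ((continuous_const.mul continuous_id).tendsto 0).mono_left nhdsWithin_le_nhds
    have h3 := h1.sub h2
    have e : M' 0 / M 0 - c * 0 = (∑ b ∈ s, g b) / (s.card : ℝ) := by
      rw [hM0]; simp [hM']
    rw [e] at h3
    refine h3.congr fun r => ?_
    simp [hu, slope_def_field, hK0]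
  have hle : u r ≤ (∑ b ∈ s, g b) / (s.card : ℝ) := by
    refine ge_of_tendsto hlim ?_
    filter_upwards [Ioo_mem_nhdsGT hr] with q hq
    exact hanti hq.1 hr hq.2.le
  have hKr : K r ≤ r * ((∑ b ∈ s, g b) / (s.card : ℝ)) + c * r ^ 2 := by
    have h1 : K r / r ≤ (∑ b ∈ s, g b) / (s.card : ℝ) + c * r := by
      simp only [hu] at hle; linarith
    rw [div_le_iff₀ hr] at h1
    linarith
  exact (log_le_iff_le_exp (hMpos r)).1 hKr

variable {α : Type*} [DecidableEq α]

/-- Only the exponential at the larger endpoint appears. After reversibility, control of the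
decreases of `g` alone therefore suffices. -/
lemma logDiv_exp_le (a b : ℝ) :
    logDiv (exp a) (exp b) ≤ exp a * max (a - b) 0 ^ 2 + exp b * max (b - a) 0 ^ 2 := by
  have key : ∀ a b : ℝ, b ≤ a → (exp a - exp b) * (a - b) ≤ exp a * (a - b) ^ 2 := by
    intro a b hab
    have h1 : exp a - exp b ≤ exp a * (a - b) := by
      have h2 := add_one_le_exp (b - a)
      have h3 : exp b = exp a * exp (b - a) := by rw [← exp_add]; ring_nf
      rw [h3]
      nlinarith [exp_pos a]
    calc (exp a - exp b) * (a - b) ≤ exp a * (a - b) * (a - b) :=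
          mul_le_mul_of_nonneg_right h1 (sub_nonneg.2 hab)
      _ = exp a * (a - b) ^ 2 := by ring
  unfold logDiv
  rw [log_exp, log_exp]
  rcases le_total b a with h | h
  · rw [max_eq_left (sub_nonneg.2 h), max_eq_right (sub_nonpos.2 h)]
    linarith [key a b h]
  · rw [max_eq_right (sub_nonpos.2 h), max_eq_left (sub_nonneg.2 h)]
    linarith [key b a h]

lemma sliceDirichlet_exp_le (U : Finset α) (m : ℕ) (g : Finset α → ℝ) :
    sliceDirichlet U m (fun S => exp (g S)) ≤
      2 * ∑ S ∈ U.powersetCard m, exp (g S) *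
        ∑ x ∈ S, ∑ y ∈ U \ S, max (g S - g (exchange S x y)) 0 ^ 2 := by
  have h1 : sliceDirichlet U m (fun S => exp (g S)) ≤
      ∑ S ∈ U.powersetCard m, ∑ x ∈ S, ∑ y ∈ U \ S,
        (exp (g S) * max (g S - g (exchange S x y)) 0 ^ 2 +
          exp (g (exchange S x y)) * max (g (exchange S x y) - g S) 0 ^ 2) :=
    sum_le_sum fun S _ => sum_le_sum fun x _ => sum_le_sum fun y _ => logDiv_exp_le _ _
  simp only [sum_add_distrib] at h1
  rw [sum_exchange_symm U m (fun A C => exp (g A) * max (g A - g C) 0 ^ 2), ← two_mul] at h1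
  simpa only [mul_sum] using h1

/-- Expand the square; the cross term is at most the sum of the two squared sums, and Cauchy–Schwarz
supplies the missing diagonal contributions. -/
lemma sum_sq_sub_le {S T : Finset α} (hST : Disjoint S T) (F : α → ℝ) :
    ∑ x ∈ S, ∑ y ∈ T, (F y - F x) ^ 2 ≤
      ((S.card : ℝ) + T.card) * ∑ z ∈ S ∪ T, F z ^ 2 := by
  have e : ∑ x ∈ S, ∑ y ∈ T, (F y - F x) ^ 2 =
      S.card * ∑ y ∈ T, F y ^ 2 + T.card * ∑ x ∈ S, F x ^ 2 -
        2 * ((∑ x ∈ S, F x) * ∑ y ∈ T, F y) := by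
    have : ∀ x ∈ S, ∑ y ∈ T, (F y - F x) ^ 2 =
        ∑ y ∈ T, F y ^ 2 + T.card * F x ^ 2 - 2 * (F x * ∑ y ∈ T, F y) := by
      intro x _
      rw [mul_sum, mul_sum, ← nsmul_eq_mul, ← sum_const, ← sum_add_distrib, ← sum_sub_distrib]
      exact sum_congr rfl fun y _ => by ring
    rw [sum_congr rfl this, sum_sub_distrib, sum_add_distrib, sum_const, nsmul_eq_mul,
      ← mul_sum, ← mul_sum, ← sum_mul]
  rw [e, sum_union hST]
  have hS := sq_sum_le_card_mul_sum_sq (s := S) (f := F)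
  have hT := sq_sum_le_card_mul_sum_sq (s := T) (f := F)
  nlinarith [sq_nonneg (∑ x ∈ S, F x + ∑ y ∈ T, F y)]

/-- Sub-Gaussian upper deviation inequality under sampling without replacement, for functions whose
one-sided increments are controlled by increments of functions with `∑ F² ≤ v`. -/
theorem card_filter_lt_le {U : Finset α} {m : ℕ} (hmU : m ≤ U.card) (hU : 0 < U.card)
    (g : Finset α → ℝ) {v : ℝ} (hv : 0 < v)
    (hg : ∀ S ∈ U.powersetCard m, ∃ F : α → ℝ, ∑ z ∈ U, F z ^ 2 ≤ v ∧
      ∀ x ∈ S, ∀ y ∈ U \ S, g S - g (exchange S x y) ≤ F y - F x)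
    {u : ℝ} (hu : 0 < u) :
    (((U.powersetCard m).filter fun S =>
        (∑ S ∈ U.powersetCard m, g S) / ((U.powersetCard m).card : ℝ) + u < g S).card : ℝ) ≤
      (U.powersetCard m).card * exp (-(u ^ 2 / (8 * v))) := by
  have hne : (U.powersetCard m).Nonempty := powersetCard_nonempty.2 hmU
  have hZ : (0 : ℝ) < (U.powersetCard m).card := by exact_mod_cast hne.card_pos
  have hU' : (0 : ℝ) < U.card := by exact_mod_cast hU
  have hV : ∀ S ∈ U.powersetCard m,
      ∑ x ∈ S, ∑ y ∈ U \ S, max (g S - g (exchange S x y)) 0 ^ 2 ≤ U.card * v := by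
    intro S hS
    obtain ⟨F, hF, hFg⟩ := hg S hS
    have hSU := (mem_powersetCard.1 hS).1
    calc ∑ x ∈ S, ∑ y ∈ U \ S, max (g S - g (exchange S x y)) 0 ^ 2
        ≤ ∑ x ∈ S, ∑ y ∈ U \ S, (F y - F x) ^ 2 := by
          refine sum_le_sum fun x hx => sum_le_sum fun y hy => ?_
          have h1 := hFg x hx y hy
          rcases le_total (g S - g (exchange S x y)) 0 with h | h
          · rw [max_eq_right h]; nlinarith [sq_nonneg (F y - F x)]
          · rw [max_eq_left h]; exact pow_le_pow_left₀ h h1 2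
      _ ≤ ((S.card : ℝ) + (U \ S).card) * ∑ z ∈ S ∪ U \ S, F z ^ 2 :=
          sum_sq_sub_le disjoint_sdiff F
      _ = U.card * ∑ z ∈ U, F z ^ 2 := by
          rw [union_sdiff_of_subset hSU, ← Nat.cast_add, add_comm, card_sdiff_add_card_eq_card hSU]
      _ ≤ U.card * v := mul_le_mul_of_nonneg_left hF hU'.le
  have hent : ∀ r : ℝ, 0 < r → ∑ S ∈ U.powersetCard m, exp (r * g S) * (r * g S) -
      (∑ S ∈ U.powersetCard m, exp (r * g S)) *
        log ((∑ S ∈ U.powersetCard m, exp (r * g S)) / ((U.powersetCard m).card : ℝ)) ≤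
        2 * v * r ^ 2 * ∑ S ∈ U.powersetCard m, exp (r * g S) := by
    intro r hr
    have h1 := card_mul_sliceEntropy_le U m (fun S => exp (r * g S)) fun S => exp_pos _
    have h2 := sliceDirichlet_exp_le U m (fun S => r * g S)
    have h3 : ∑ S ∈ U.powersetCard m, exp (r * g S) *
        ∑ x ∈ S, ∑ y ∈ U \ S, max (r * g S - r * g (exchange S x y)) 0 ^ 2 ≤
        ∑ S ∈ U.powersetCard m, exp (r * g S) * (r ^ 2 * (U.card * v)) := by
      refine sum_le_sum fun S hS => mul_le_mul_of_nonneg_left ?_ (exp_pos _).le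
      have e : ∀ a : ℝ, max (r * g S - r * a) 0 ^ 2 = r ^ 2 * max (g S - a) 0 ^ 2 := by
        intro a
        rw [← mul_pow, mul_max_of_nonneg _ _ hr.le, mul_zero, mul_sub]
      simp only [e, ← mul_sum]
      exact mul_le_mul_of_nonneg_left (hV S hS) (sq_nonneg r)
    rw [← sum_mul] at h3
    have h4 : (U.card : ℝ) * sliceEntropy U m (fun S => exp (r * g S)) ≤
        U.card * (2 * v * r ^ 2 * ∑ S ∈ U.powersetCard m, exp (r * g S)) := by linarith
    have h5 := le_of_mul_le_mul_left h4 hU'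
    simpa only [sliceEntropy, log_exp] using h5
  set μ := (∑ S ∈ U.powersetCard m, g S) / ((U.powersetCard m).card : ℝ) with hμ
  -- Minimizer of the Chernoff exponent `-r * u + 2 * v * r ^ 2`.
  set r := u / (4 * v) with hr
  have hrp : 0 < r := by positivity
  have hmgf := sum_exp_le_of_entropy_le hne g (2 * v) hent hrp
  rw [← hμ, div_le_iff₀ hZ] at hmgf
  set A := (U.powersetCard m).filter fun S => μ + u < g S with hA
  have h1 : (A.card : ℝ) * exp (r * (μ + u)) ≤ ∑ S ∈ U.powersetCard m, exp (r * g S) := by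
    calc (A.card : ℝ) * exp (r * (μ + u)) = ∑ S ∈ A, exp (r * (μ + u)) := by
          rw [sum_const, nsmul_eq_mul]
      _ ≤ ∑ S ∈ A, exp (r * g S) := sum_le_sum fun S hS =>
          exp_le_exp.2 (mul_le_mul_of_nonneg_left (mem_filter.1 hS).2.le hrp.le)
      _ ≤ _ := sum_le_sum_of_subset_of_nonneg (filter_subset _ _) fun _ _ _ => (exp_pos _).le
  have h2 := h1.trans hmgf
  have h3 : exp (r * μ + 2 * v * r ^ 2) = exp (-(u ^ 2 / (8 * v))) * exp (r * (μ + u)) := by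
    rw [← exp_add]
    congr 1
    rw [hr]
    field_simp
    ring
  rw [h3, mul_right_comm, mul_comm _ ((U.powersetCard m).card : ℝ)] at h2
  exact le_of_mul_le_mul_right h2 (exp_pos _)

/-! ### Peeling, sub-root functions and uniform deviations. -/

section Localization

variable {X Y : Type*}

lemma mean_eq (A : Finset X) (f : X → ℝ) : mean A f = (∑ x ∈ A, f x) / (A.card : ℝ) :=
  expect_eq_sum_div_card _ _

lemma sampleExpectation_eq (XN : Finset X) (m : ℕ) (g : Finset X → ℝ) :
    sampleExpectation XN m g =
      (∑ S ∈ XN.powersetCard m, g S) / ((XN.powersetCard m).card : ℝ) :=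
  expect_eq_sum_div_card _ _

lemma mean_sub (A : Finset X) (f g : X → ℝ) : mean A (f - g) = mean A f - mean A g := by
  simp only [mean_eq, Pi.sub_apply, sum_sub_distrib, sub_div]

lemma mean_le_of_le {A : Finset X} (hA : A.Nonempty) {f : X → ℝ} {c : ℝ} (h : ∀ x, f x ≤ c) :
    mean A f ≤ c :=
  expect_le hA fun x _ => h x

lemma le_mean_of_le {A : Finset X} (hA : A.Nonempty) {f : X → ℝ} {c : ℝ} (h : ∀ x, c ≤ f x) :
    c ≤ mean A f :=
  le_expect hA fun x _ => h x

/-- The constant `c` matters only as a bound: the real `sSup` of an unbounded set would be the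
default `0`. -/
lemma le_localizedSup {XN : Finset X} {F : Set (X → ℝ)} {S : Finset X} {c : ℝ}
    (hF : ∀ f ∈ F, mean XN f - mean S f ≤ c) {r : ℝ} {f : X → ℝ} (hf : f ∈ F)
    (hfr : mean XN (fun x => f x ^ 2) ≤ r) :
    mean XN f - mean S f ≤ localizedSup XN F r S := by
  refine le_csSup ⟨c, ?_⟩ ⟨f, ⟨hf, hfr⟩, rfl⟩
  rintro _ ⟨f, hf, rfl⟩
  exact hF f hf.1

lemma localizedSup_nonneg {XN : Finset X} {F : Set (X → ℝ)} {S : Finset X} {c : ℝ}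
    (hF : ∀ f ∈ F, mean XN f - mean S f ≤ c) (h0 : (0 : X → ℝ) ∈ F) {r : ℝ} (hr : 0 ≤ r) :
    0 ≤ localizedSup XN F r S := by
  have h : mean XN (fun x => (0 : X → ℝ) x ^ 2) ≤ r := by simpa [mean_eq] using hr
  simpa [mean_eq] using le_localizedSup hF h0 h

/-- Peeling: rescaled deviations are bounded by a geometric sum of localized suprema. -/
lemma rescaled_deviation_le {XN : Finset X} {F : Set (X → ℝ)} {S : Finset X} {c : ℝ}
    (hF : ∀ f ∈ F, mean XN f - mean S f ≤ c) (h0 : (0 : X → ℝ) ∈ F) {r : ℝ} (hr : 0 < r)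
    {K : ℕ} (hK : 1 < 4 ^ K * r) {f : X → ℝ} (hf : f ∈ F)
    (hf1 : mean XN (fun x => f x ^ 2) ≤ 1) :
    r / max r (mean XN (fun x => f x ^ 2)) * (mean XN f - mean S f) ≤
      localizedSup XN F r S +
        ∑ k ∈ range K, (1 / 4 : ℝ) ^ k * localizedSup XN F (4 ^ (k + 1) * r) S := by
  set s := mean XN (fun x => f x ^ 2) with hs
  have hnn : ∀ k ∈ range K, 0 ≤ (1 / 4 : ℝ) ^ k * localizedSup XN F (4 ^ (k + 1) * r) S :=
    fun k _ => mul_nonneg (by positivity) (localizedSup_nonneg hF h0 (by positivity))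
  rcases le_or_gt s r with hsr | hsr
  · rw [max_eq_left hsr, div_self hr.ne', one_mul]
    have h1 := le_localizedSup hF hf (hs ▸ hsr)
    linarith [sum_nonneg hnn]
  · rw [max_eq_right hsr.le]
    have hs0 : 0 < s := hr.trans hsr
    -- The band `4 ^ k * r ≤ s < 4 ^ (k + 1) * r` containing the second moment; on it the weight `r
    -- / s` is at most `4⁻ᵏ`.
    obtain ⟨k, hk1, hk2⟩ := exists_nat_pow_near (one_le_div hr |>.2 hsr.le)
      (by norm_num : (1 : ℝ) < 4)
    rw [le_div_iff₀ hr] at hk1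
    rw [div_lt_iff₀ hr] at hk2
    have hkK : k < K := by
      by_contra h
      have h2 : (4 : ℝ) ^ K * r ≤ 4 ^ k * r :=
        mul_le_mul_of_nonneg_right (pow_le_pow_right₀ (by norm_num) (not_lt.1 h)) hr.le
      linarith
    have hw : r / s ≤ (1 / 4 : ℝ) ^ k := by
      rw [div_le_iff₀ hs0, one_div, inv_pow, inv_mul_eq_div, le_div_iff₀ (by positivity)]
      linarith
    have hL := le_localizedSup hF hf (hs ▸ hk2.le)
    have hL0 := localizedSup_nonneg (S := S) hF h0
      (by positivity : (0 : ℝ) ≤ 4 ^ (k + 1) * r)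
    calc r / s * (mean XN f - mean S f)
        ≤ r / s * localizedSup XN F (4 ^ (k + 1) * r) S :=
          mul_le_mul_of_nonneg_left hL (by positivity)
      _ ≤ (1 / 4 : ℝ) ^ k * localizedSup XN F (4 ^ (k + 1) * r) S :=
          mul_le_mul_of_nonneg_right hw hL0
      _ ≤ ∑ k ∈ range K, (1 / 4 : ℝ) ^ k * localizedSup XN F (4 ^ (k + 1) * r) S :=
          single_le_sum hnn (mem_range.2 hkK)
      _ ≤ _ := le_add_of_nonneg_left (localizedSup_nonneg hF h0 hr.le)

lemma IsSubRoot.mul_sqrt_le {ψ : ℝ → ℝ} (hψ : IsSubRoot ψ) {r q : ℝ} (hr : 0 < r) (hrq : r ≤ q) :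
    ψ q * √r ≤ ψ r * √q := by
  have h := hψ.antitoneOn hr (hr.trans_le hrq) hrq
  exact (div_le_div_iff₀ (sqrt_pos.2 (hr.trans_le hrq)) (sqrt_pos.2 hr)).1 h

lemma IsSubRoot.four_pow_mul_le {ψ : ℝ → ℝ} (hψ : IsSubRoot ψ) {r : ℝ} (hr : 0 < r) (k : ℕ) :
    ψ (4 ^ k * r) ≤ 2 ^ k * ψ r := by
  have h4 : (1 : ℝ) ≤ 4 ^ k := one_le_pow₀ (by norm_num)
  have h := hψ.mul_sqrt_le hr (le_mul_of_one_le_left hr.le h4)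
  have e : √((4 : ℝ) ^ k) = 2 ^ k := by
    rw [show (4 : ℝ) = 2 ^ 2 by norm_num, ← pow_mul, mul_comm, pow_mul, sqrt_sq (by positivity)]
  rw [sqrt_mul (by positivity), e, ← mul_assoc] at h
  have := le_of_mul_le_mul_right h (sqrt_pos.2 hr)
  linarith

/-- A band of radius `4 ^ (k + 1) * r` costs `2 ^ (k + 1) * ψ r` against the weight `4⁻ᵏ`, so `5 = 1
+ 2 * ∑ 2⁻ᵏ`. -/
lemma sum_peeling_le {ψ : ℝ → ℝ} (hψ : IsSubRoot ψ) {r : ℝ} (hr : 0 < r) (K : ℕ) :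
    ψ r + ∑ k ∈ range K, (1 / 4 : ℝ) ^ k * ψ (4 ^ (k + 1) * r) ≤ 5 * ψ r := by
  have h0 := hψ.nonneg r hr.le
  have h1 : ∑ k ∈ range K, (1 / 4 : ℝ) ^ k * ψ (4 ^ (k + 1) * r) ≤
      ∑ k ∈ range K, (1 / 2 : ℝ) ^ k * (2 * ψ r) := by
    refine sum_le_sum fun k _ => ?_
    calc (1 / 4 : ℝ) ^ k * ψ (4 ^ (k + 1) * r) ≤ (1 / 4 : ℝ) ^ k * (2 ^ (k + 1) * ψ r) :=
          mul_le_mul_of_nonneg_left (hψ.four_pow_mul_le hr _) (by positivity)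
      _ = ((1 / 4 : ℝ) * 2) ^ k * (2 * ψ r) := by rw [mul_pow]; ring
      _ = (1 / 2 : ℝ) ^ k * (2 * ψ r) := by norm_num
  have h2 : ∑ k ∈ range K, (1 / 2 : ℝ) ^ k ≤ 2 := by
    simpa using sum_geometric_two_le K
  rw [← sum_mul] at h1
  nlinarith

lemma sampleExpectation_peeling_le {XN : Finset X} {m : ℕ} {F : Set (X → ℝ)} {ψ : ℝ → ℝ} {B r : ℝ}
    (hψ : IsSubRoot ψ)
    (hbound : ∀ r, 0 ≤ r → B * sampleExpectation XN m (localizedSup XN F r) ≤ ψ r)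
    (hr : 0 < r) (K : ℕ) :
    B * sampleExpectation XN m (fun S => localizedSup XN F r S +
      ∑ k ∈ range K, (1 / 4 : ℝ) ^ k * localizedSup XN F (4 ^ (k + 1) * r) S) ≤ 5 * ψ r := by
  refine le_trans ?_ (sum_peeling_le hψ hr K)
  have e : B * sampleExpectation XN m (fun S => localizedSup XN F r S +
      ∑ k ∈ range K, (1 / 4 : ℝ) ^ k * localizedSup XN F (4 ^ (k + 1) * r) S) =
      B * sampleExpectation XN m (localizedSup XN F r) + ∑ k ∈ range K, (1 / 4 : ℝ) ^ k *
        (B * sampleExpectation XN m (localizedSup XN F (4 ^ (k + 1) * r))) := by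
    simp only [sampleExpectation, expect_add_distrib, expect_sum_comm, ← mul_expect, mul_add,
      mul_sum]
    congr 1
    exact sum_congr rfl fun k _ => by ring
  rw [e]
  gcongr with k
  · exact hbound r hr.le
  · exact hbound _ (by positivity)

/-- The uniform deviation inequality for a finite family of functions with second moments at most
`r`, under sampling without replacement. -/
lemma card_filter_uniform_deviation_le {XN : Finset X} {m : ℕ} (hm : 1 ≤ m) (hmN : m ≤ XN.card)
    {ι : Type*} {I : Finset ι} (hI : I.Nonempty) (F : ι → X → ℝ) {r : ℝ} (hr : 0 < r)
    (hF : ∀ i ∈ I, mean XN (fun x => F i x ^ 2) ≤ r) {ε : ℝ} (hε : 0 < ε) :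
    (((XN.powersetCard m).filter fun S =>
        sampleExpectation XN m (fun S => I.sup' hI fun i => mean XN (F i) - mean S (F i)) + ε <
          I.sup' hI fun i => mean XN (F i) - mean S (F i)).card : ℝ) ≤
      (XN.powersetCard m).card * exp (-((m * ε) ^ 2 / (8 * (XN.card * r)))) := by
  classical
  have hm0 : (0 : ℝ) < m := by exact_mod_cast hm
  have hN : 0 < XN.card := by omega
  have hN0 : (0 : ℝ) < XN.card := by exact_mod_cast hN
  set Q : Finset X → ℝ := fun S => I.sup' hI fun i => mean XN (F i) - mean S (F i) with hQ
  have h := card_filter_lt_le (U := XN) hmN hN (fun S => m * Q S)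
    (v := XN.card * r) (by positivity) ?_ (u := m * ε) (by positivity)
  · rw [sampleExpectation_eq]
    refine le_trans (le_of_eq ?_) h
    congr 2
    refine filter_congr fun S _ => ?_
    rw [← mul_sum, mul_div_assoc, ← mul_add]
    exact (mul_lt_mul_iff_right₀ hm0).symm
  · intro S hS
    obtain ⟨hSU, hSc⟩ := mem_powersetCard.1 hS
    -- The maximizer at `S` remains a competitor after the exchange, so the decrease of `m * Q` is
    -- at most the change in its own sample sum.
    obtain ⟨i, hi, hiQ⟩ := exists_mem_eq_sup' hI fun i => mean XN (F i) - mean S (F i)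
    refine ⟨F i, ?_, fun x hx y hy => ?_⟩
    · have := hF i hi
      rw [mean_eq, div_le_iff₀ hN0] at this
      linarith
    · have h1 : mean XN (F i) - mean (exchange S x y) (F i) ≤ Q (exchange S x y) :=
        le_sup' (fun i => mean XN (F i) - mean (exchange S x y) (F i)) hi
      have hyS : y ∉ S.erase x := fun h' => (mem_sdiff.1 hy).2 (mem_of_mem_erase h')
      have hcard : (exchange S x y).card = m := by
        rw [exchange, card_insert_of_notMem hyS, card_erase_add_one hx, hSc]
      have h2 : (m : ℝ) * mean S (F i) = ∑ z ∈ S, F i z := by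
        rw [mean_eq, hSc, mul_div_cancel₀ _ hm0.ne']
      have h3 : (m : ℝ) * mean (exchange S x y) (F i) = ∑ z ∈ exchange S x y, F i z := by
        rw [mean_eq, hcard, mul_div_cancel₀ _ hm0.ne']
      rw [exchange, sum_insert hyS, ← exchange] at h3
      have h4 := add_sum_erase S (F i) hx
      have h5 := mul_le_mul_of_nonneg_left h1 hm0.le
      have h6 : Q S = mean XN (F i) - mean S (F i) := hiQ
      simp only [h6]
      linarith

end Localization

/-! ### Excess losses and the final risk bound. -/

section ExcessLoss

variable {X Y : Type*} {ℓ : Y → Y → ℝ} {φ : X → Y} {H : Set (X → Y)} {h₀ : X → Y}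

lemma abs_le_one_of_mem_excessLossClass (hℓ : ∀ y y', 0 ≤ ℓ y y' ∧ ℓ y y' ≤ 1) {f : X → ℝ}
    (hf : f ∈ excessLossClass ℓ φ H h₀) (x : X) : |f x| ≤ 1 := by
  obtain ⟨h, -, rfl⟩ := hf
  simp only [Pi.sub_apply, lossOf]
  have h1 := hℓ (h x) (φ x)
  have h2 := hℓ (h₀ x) (φ x)
  rw [abs_le]
  constructor <;> linarith

lemma zero_mem_excessLossClass (hmem : h₀ ∈ H) : (0 : X → ℝ) ∈ excessLossClass ℓ φ H h₀ :=
  ⟨h₀, hmem, (sub_self _).symm⟩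

lemma mean_sub_mean_le_two (hℓ : ∀ y y', 0 ≤ ℓ y y' ∧ ℓ y y' ≤ 1) {A S : Finset X}
    (hA : A.Nonempty) (hS : S.Nonempty) {f : X → ℝ} (hf : f ∈ excessLossClass ℓ φ H h₀) :
    mean A f - mean S f ≤ 2 := by
  have h := fun x => abs_le.1 (abs_le_one_of_mem_excessLossClass hℓ hf x)
  have h1 := mean_le_of_le hA fun x => (h x).2
  have h2 := le_mean_of_le hS fun x => (h x).1
  linarith

end ExcessLoss

lemma one_sub_lt_sampleProb {X : Type*} {XN : Finset X} {m : ℕ} (hm : m ≤ XN.card)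
    {p q : Finset X → Prop} [DecidablePred q] (hpq : ∀ S ∈ XN.powersetCard m, ¬ q S → p S) {δ : ℝ}
    (hq : (((XN.powersetCard m).filter q).card : ℝ) < (XN.powersetCard m).card * δ) :
    1 - δ < sampleProb XN m p := by
  classical
  have hZ : (0 : ℝ) < (XN.powersetCard m).card := by
    exact_mod_cast (powersetCard_nonempty.2 hm).card_pos
  have h1 : ((XN.powersetCard m).filter q).card + ((XN.powersetCard m).filter fun S => ¬ q S).card =
      (XN.powersetCard m).card := card_filter_add_card_filter_not _
  have h2 : ((XN.powersetCard m).filter fun S => ¬ q S).card ≤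
      ((XN.powersetCard m).filter p).card :=
    card_le_card fun S hS =>
      mem_filter.2 ⟨(mem_filter.1 hS).1, hpq S (mem_filter.1 hS).1 (mem_filter.1 hS).2⟩
  have h3 : ((XN.powersetCard m).card : ℝ) ≤
      ((XN.powersetCard m).filter q).card + ((XN.powersetCard m).filter p).card := by
    exact_mod_cast (by omega : (XN.powersetCard m).card ≤
      ((XN.powersetCard m).filter q).card + ((XN.powersetCard m).filter p).card)
  unfold sampleProb
  rw [lt_div_iff₀ hZ]
  have : ((XN.powersetCard m).card : ℝ) - (XN.powersetCard m).card * δ <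
      ((XN.powersetCard m).filter p).card := by linarith
  rw [sub_mul, one_mul, mul_comm δ]
  convert this

/-- If the rescaled mean of `f` is below `r / B` and `f` satisfies the Bernstein condition, then so
is the mean of `f`. -/
lemma mul_lt_of_rescaled_mul_lt {e s B r : ℝ} (hr : 0 < r) (hs : s ≤ B * e)
    (h : B * (r / max r s * e) < r) : B * e < r := by
  rcases le_or_gt s r with hsr | hsr
  · rwa [max_eq_left hsr, div_self hr.ne', one_mul] at h
  -- Were scaling active, the Bernstein condition would give `r = r / s * s ≤ r / s * (B * e) < r`.
  · exfalso
    have hs0 : 0 < s := hr.trans hsr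
    rw [max_eq_right hsr.le] at h
    have h1 : r / s * (B * e) < r := by linarith
    have h2 : r / s * s ≤ r / s * (B * e) := mul_le_mul_of_nonneg_left hs (by positivity)
    rw [div_mul_cancel₀ _ hs0.ne'] at h2
    linarith

end Transductive

open Transductive in
theorem mainTheorem5 {X Y : Type*}
    -- the loss, with values in `[0, 1]`, the labelling function and the hypothesis set
    (ℓ : Y → Y → ℝ) (hℓ : ∀ y y', 0 ≤ ℓ y y' ∧ ℓ y y' ≤ 1)
    (φ : X → Y) (H : Set (X → Y))
    -- the `N` input points and the size of the training set
    (XN : Finset X) (N m : ℕ) (hN : XN.card = N) (hm : 1 ≤ m) (hmN : m ≤ N)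
    -- a minimizer of the overall risk over `H`
    (hstar : X → Y) (hstar_mem : hstar ∈ H)
    (hstar_min : IsMinOn (Transductive.risk ℓ φ XN) H hstar)
    -- the Bernstein condition on the excess loss class
    (B : ℝ) (hB : 0 < B)
    (hBernstein : ∀ f ∈ Transductive.excessLossClass ℓ φ H hstar,
      Transductive.mean XN (fun x => f x ^ 2) ≤ B * Transductive.mean XN f)
    -- the sub-root bound on the localized complexity, and the fixed point
    (ψ : ℝ → ℝ) (hψ : Transductive.IsSubRoot ψ)
    (hψ_bound : ∀ r, 0 ≤ r →
      B * Transductive.sampleExpectation XN m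
        (Transductive.localizedSup XN (Transductive.excessLossClass ℓ φ H hstar) r) ≤ ψ r)
    (rstar : ℝ) (hrstar_pos : 0 < rstar) (hrstar : ψ rstar = rstar)
    -- empirical risk minimization: `hhat S` minimizes the training error on `S` over `H`
    (hhat : Finset X → X → Y)
    (hhat_mem : ∀ S ∈ XN.powersetCard m, hhat S ∈ H)
    (hhat_min : ∀ S ∈ XN.powersetCard m, IsMinOn (Transductive.risk ℓ φ S) H (hhat S))
    (t : ℝ) (ht : 0 < t) :
    1 - Real.exp (-t) <
      Transductive.sampleProb XN m (fun S =>
        Transductive.risk ℓ φ XN (hhat S) - Transductive.risk ℓ φ XN hstar ≤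
          51 * (rstar / B) + 17 * B * t * ((N : ℝ) / (m : ℝ) ^ 2)) := by
  classical
  subst hN
  have hm0 : (0 : ℝ) < m := by exact_mod_cast hm
  have hN0 : (0 : ℝ) < XN.card := by exact_mod_cast (by omega : 0 < XN.card)
  have hXN : XN.Nonempty := Finset.card_pos.1 (by omega)
  have hSne : ∀ S ∈ XN.powersetCard m, S.Nonempty := fun S hS =>
    Finset.card_pos.1 (by rw [(Finset.mem_powersetCard.1 hS).2]; omega)
  have hI : (XN.powersetCard m).Nonempty := Finset.powersetCard_nonempty.2 hmN
  set a := √rstar with ha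
  have ha0 : 0 < a := Real.sqrt_pos.2 hrstar_pos
  have haa : a ^ 2 = rstar := Real.sq_sqrt hrstar_pos.le
  -- Chosen so that `r / B`, with `r` defined below, is exactly the claimed bound.
  set b := B * √(t * XN.card) / m with hb
  have hb0 : 0 < b := by positivity
  have hbb : b ^ 2 = B ^ 2 * (t * XN.card) / (m : ℝ) ^ 2 := by
    rw [hb, div_pow, mul_pow, Real.sq_sqrt (by positivity)]
  set r := 51 * a ^ 2 + 17 * b ^ 2 with hrdef
  have hr : 0 < r := by positivity
  set q := √r with hq
  have hq0 : 0 < q := Real.sqrt_pos.2 hr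
  have hqq : q ^ 2 = r := Real.sq_sqrt hr.le
  have hqlt : 5 * a + 2.9 * b < q := by
    -- The difference `26 * a² - 29 * a * b + 8.59 * b²` has negative discriminant; `0.56` is close
    -- to the minimizer `29 / 52`.
    refine Real.lt_sqrt_of_sq_lt ?_
    rw [hrdef]
    nlinarith [sq_nonneg (a - 0.56 * b), sq_pos_of_pos ha0, sq_pos_of_pos hb0]
  have hψr : ψ r ≤ q * a := by
    have h := hψ.mul_sqrt_le hrstar_pos (q := r) (by nlinarith)
    rw [hrstar, ← ha, ← hq, ← haa] at h
    exact le_of_mul_le_mul_right (by linarith) ha0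
  set f : Finset X → X → ℝ := fun S => lossOf ℓ φ (hhat S) - lossOf ℓ φ hstar with hf
  have hfmem : ∀ S ∈ XN.powersetCard m, f S ∈ excessLossClass ℓ φ H hstar :=
    fun S hS => ⟨hhat S, hhat_mem S hS, rfl⟩
  set s : Finset X → ℝ := fun S => mean XN (fun x => f S x ^ 2) with hs
  set w : Finset X → ℝ := fun S => r / max r (s S) with hw
  have hmax : ∀ S, 0 < max r (s S) := fun S => hr.trans_le (le_max_left _ _)
  have hw0 : ∀ S, 0 < w S := fun S => div_pos hr (hmax S)
  set F : Finset X → X → ℝ := fun S x => w S * f S x with hFdef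
  have hmeanF : ∀ A S, mean A (F S) = w S * mean A (f S) := by
    intro A S
    simp only [mean_eq, hFdef, ← Finset.mul_sum, mul_div_assoc]
  have hF2 : ∀ S ∈ XN.powersetCard m, mean XN (fun x => F S x ^ 2) ≤ r := by
    intro S _
    have e : mean XN (fun x => F S x ^ 2) = w S ^ 2 * s S := by
      simp only [hs, mean_eq, hFdef, mul_pow, ← Finset.mul_sum, mul_div_assoc]
    rw [e]
    have h1 : w S * s S ≤ r := by
      rw [hw]
      simp only
      rw [div_mul_eq_mul_div, div_le_iff₀ (hmax S)]
      exact mul_le_mul_of_nonneg_left (le_max_right _ _) hr.le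
    have h2 : w S ≤ 1 := (div_le_one (hmax S)).2 (le_max_left _ _)
    nlinarith [hw0 S]
  -- The index `S` ranges over all training sets while `T` is the drawn one, so the family of
  -- functions does not depend on the draw.
  set Q : Finset X → ℝ :=
    fun T => (XN.powersetCard m).sup' hI fun S => mean XN (F S) - mean T (F S) with hQ
  set ε := 2.9 * q * b / B with hε
  have hε0 : 0 < ε := by positivity
  have hconc := card_filter_uniform_deviation_le hm hmN hI F hr hF2 hε0
  -- Since `2.9 ^ 2 = 8.41 > 8`, the exponent exceeds `t`; this slack makes the final probability
  -- bound strict.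
  have hexp : (m * ε) ^ 2 / (8 * (XN.card * r)) = 8.41 / 8 * t := by
    rw [hε, mul_pow, div_pow, mul_pow, mul_pow, hqq, hbb]
    field_simp
    norm_num
  rw [hexp] at hconc
  have hEQ : B * sampleExpectation XN m Q ≤ 5 * (q * a) := by
    obtain ⟨K, hK⟩ := pow_unbounded_of_one_lt (1 / r) (by norm_num : (1 : ℝ) < 4)
    rw [div_lt_iff₀ hr] at hK
    refine le_trans ?_ ((sampleExpectation_peeling_le hψ hψ_bound hr K).trans
      (mul_le_mul_of_nonneg_left hψr (by norm_num)))
    refine mul_le_mul_of_nonneg_left (Finset.expect_le_expect fun T hT => ?_) hB.le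
    refine Finset.sup'_le _ _ fun S hS => ?_
    rw [hmeanF, hmeanF, ← mul_sub]
    refine rescaled_deviation_le (c := 2)
      (fun g hg => mean_sub_mean_le_two hℓ hXN (hSne T hT) hg)
      (zero_mem_excessLossClass hstar_mem) hr hK (hfmem S hS) ?_
    refine mean_le_of_le hXN fun x => ?_
    rw [← sq_abs]
    exact pow_le_one₀ (abs_nonneg _) (abs_le_one_of_mem_excessLossClass hℓ (hfmem S hS) x)
  -- The left side is at most `q * (5 * a + 2.9 * b)`, which is less than `q ^ 2`.
  have hU : B * (sampleExpectation XN m Q + ε) < r := by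
    have h1 : B * ε = 2.9 * q * b := by rw [hε]; field_simp
    rw [mul_add, h1, ← hqq]
    nlinarith
  refine one_sub_lt_sampleProb hmN (q := fun S => sampleExpectation XN m Q + ε < Q S) ?_ ?_
  · intro S hS hSq
    have h1 : w S * (mean XN (f S) - mean S (f S)) ≤ Q S := by
      have := Finset.le_sup' (fun S' => mean XN (F S') - mean S (F S')) hS
      simpa only [hQ, hmeanF, ← mul_sub] using this
    have h2 : mean S (f S) ≤ 0 := by
      have h := isMinOn_iff.1 (hhat_min S hS) hstar hstar_mem
      rw [hf]
      simp only [mean_sub]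
      exact sub_nonpos.2 h
    have h3 : w S * mean XN (f S) ≤ sampleExpectation XN m Q + ε :=
      le_trans (mul_le_mul_of_nonneg_left (by linarith) (hw0 S).le) (h1.trans (not_lt.1 hSq))
    have h4 : B * mean XN (f S) < r :=
      mul_lt_of_rescaled_mul_lt hr (hBernstein (f S) (hfmem S hS))
        ((mul_le_mul_of_nonneg_left h3 hB.le).trans_lt hU)
    have h5 : risk ℓ φ XN (hhat S) - risk ℓ φ XN hstar = mean XN (f S) := (mean_sub _ _ _).symm
    rw [h5]
    have h6 : 51 * (rstar / B) + 17 * B * t * ((XN.card : ℝ) / (m : ℝ) ^ 2) = r / B := by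
      rw [hrdef, haa, hbb]
      field_simp
    rw [h6, le_div_iff₀ hB]
    linarith
  · refine hconc.trans_lt (mul_lt_mul_of_pos_left ?_ (by exact_mod_cast hI.card_pos))
    exact Real.exp_lt_exp.2 (by linarith)
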